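/- Let $1\le d'<d$, $n\in\mathbb N$, $\delta\in(0,1)$ and $B\in\mathbb R$. Let $D^s$ and $D^t$ (source and target) be probability distributions on $\mathbb R^d$ whose data satisfy $\|x\|^2\le B$ almost surely, with covariance matrices $C^s,C^t$; write $\lambda^s_1\ge\dots\ge\lambda^s_d$ and $\lambda^t_1\ge\dots\ge\lambda^t_d$ for their eigenvalues, and assume $\lambda^s_{d'}>\lambda^s_{d'+1}$ and $\lambda^t_{d'}>\lambda^t_{d'+1}$. Let $\tilde C^s$ and $\tilde C^t$ be the sample covariance matrices of $n$ i.i.d. samples from $D^s$ and of $n$ i.i.d. samples from $D^t$. Put $$E(\delta)=\frac{4B}{\sqrt n}\Bigl(1+\sqrt{\tfrac{\ln(1/\delta)}{2}}\Bigr),\qquad e(d')=\frac{\sqrt{d'}}{\lambda^s_{d'}-\lambda^s_{d'+1}}+\frac{\sqrt{d'}}{\lambda^t_{d'}-\lambda^t_{d'+1}},$$ and assume that for both $*\in\{s,t\}$ $$n\ \ge\ \Bigl(\frac{4B}{\lambda^*_{d'}-\lambda^*_{d'+1}}\Bigl(1+\sqrt{\tfrac{\ln(1/\delta)}{2}}\Bigr)\Bigr)^2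 .$$ For symmetric positive semidefinite $d\times d$ matrices $A,A'$ let $d_{\mathcal M}(A,A')=\frac1{d^2}\|UU^T-U'U'^T\|_F^2$, where $U$ and $U'$ are $d\times d'$ matrices whose columns are orthonormal eigenvectors belonging to the $d'$ largest eigenvalues of $A$ and of $A'$, respectively. Then with probability at least $1-\delta$, whatever choice of such eigenvectors is made, $$\bigl|d_{\mathcal M}(C^s,C^t)-d_{\mathcal M}(\tilde C^s,\tilde C^t)\bigr|\ \le\ 2\sqrt2\,E(\delta)\,e(d').$$ -/

import Mathlib

open MeasureTheory ProbabilityTheory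

/-- The covariance matrix of a distribution `D` on `ℝᵈ`: its `(i, j)` entry is the covariance of
the `i`-th and `j`-th coordinates under `D`. -/
noncomputable def covMatrix {d : ℕ} (D : Measure (EuclideanSpace ℝ (Fin d))) :
    Matrix (Fin d) (Fin d) ℝ :=
  Matrix.of fun i j => covariance (fun x => x i) (fun x => x j) D

theorem covMatrix_isHermitian {d : ℕ} (D : Measure (EuclideanSpace ℝ (Fin d))) :
    (covMatrix D).IsHermitian := by
  ext i j
  simp [covMatrix, covariance_comm]

/-- The mean of the sample `x₁, …, xₙ`. -/
noncomputable def sampleMean {d n : ℕ} (x : Fin n → EuclideanSpace ℝ (Fin d)) :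
    EuclideanSpace ℝ (Fin d) :=
  (1 / (n : ℝ)) • ∑ k, x k

/-- The (centred) sample covariance matrix of `x₁, …, xₙ`. The normalisation by `n` or by `n - 1`
is immaterial for its eigenvectors. -/
noncomputable def sampleCovMatrix {d n : ℕ} (x : Fin n → EuclideanSpace ℝ (Fin d)) :
    Matrix (Fin d) (Fin d) ℝ :=
  Matrix.of fun i j =>
    (1 / (n : ℝ)) * ∑ k, (x k i - sampleMean x i) * (x k j - sampleMean x j)

theorem sampleCovMatrix_isHermitian {d n : ℕ} (x : Fin n → EuclideanSpace ℝ (Fin d)) :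
    (sampleCovMatrix x).IsHermitian := by
  ext i j
  simp [sampleCovMatrix, mul_comm]

/-- `eigval hA i` is the `i`-th largest eigenvalue of the symmetric matrix `A`, counted with
multiplicity, for `1 ≤ i ≤ d` (and `0` for other `i`). -/
noncomputable def eigval {d : ℕ} {A : Matrix (Fin d) (Fin d) ℝ} (hA : A.IsHermitian) (i : ℕ) : ℝ :=
  if h : 1 ≤ i ∧ i ≤ d then hA.eigenvalues₀ ⟨i - 1, by rw [Fintype.card_fin]; omega⟩ else 0

/-- `U` is a `d × k` column-orthonormal matrix whose columns are the first `k` eigenvectors of the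
symmetric matrix `A`: the `j`-th column belongs to the `j`-th largest eigenvalue. -/
def IsDominantFrame {d k : ℕ} {A : Matrix (Fin d) (Fin d) ℝ} (hA : A.IsHermitian)
    (U : Matrix (Fin d) (Fin k) ℝ) : Prop :=
  U.transpose * U = 1 ∧
    ∀ j : Fin k, A.mulVec (U.col j) = eigval hA ((j : ℕ) + 1) • U.col j

/-- A dominant frame exists whenever `k ≤ d`. -/
theorem exists_isDominantFrame {d k : ℕ} (hk : k ≤ d) {A : Matrix (Fin d) (Fin d) ℝ}
    (hA : A.IsHermitian) : ∃ U : Matrix (Fin d) (Fin k) ℝ, IsDominantFrame hA U := by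
  let e : Fin (Fintype.card (Fin d)) ≃ Fin d := Fintype.equivOfCardEq (Fintype.card_fin _)
  let s : Fin k → Fin d := fun j => e ⟨j, by rw [Fintype.card_fin]; omega⟩
  have hs : Function.Injective s := by
    intro a b h
    have := e.injective h
    simpa [Fin.ext_iff] using this
  refine ⟨Matrix.of fun i j => hA.eigenvectorBasis (s j) i, ?_, ?_⟩
  · ext a b
    have h := (orthonormal_iff_ite.1 hA.eigenvectorBasis.orthonormal) (s b) (s a)
    simp only [PiLp.inner_apply, hs.eq_iff] at h
    simp only [Matrix.mul_apply, Matrix.transpose_apply, Matrix.of_apply, Matrix.one_apply]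
    simpa [eq_comm, mul_comm] using h
  · intro j
    have hev : eigval hA ((j : ℕ) + 1) = hA.eigenvalues (s j) := by
      have hj : (j : ℕ) + 1 ≤ d := by omega
      simp [eigval, hj, Matrix.IsHermitian.eigenvalues, s, e]
    rw [hev]
    exact hA.mulVec_eigenvectorBasis (s j)

/-- The Frobenius norm of a real matrix. -/
noncomputable def frobNorm {d : ℕ} (M : Matrix (Fin d) (Fin d) ℝ) : ℝ :=
  Real.sqrt (∑ i, ∑ j, M i j ^ 2)

/-- The Grassmannian distance `d⁻² ‖U Uᵀ - V Vᵀ‖_F²` of two subspaces of `ℝᵈ`, given by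
orthonormal bases (the columns of `U` and `V`). -/
noncomputable def grassDist {d k : ℕ} (U V : Matrix (Fin d) (Fin k) ℝ) : ℝ :=
  1 / (d : ℝ) ^ 2 * frobNorm (U * U.transpose - V * V.transpose) ^ 2

/-- The factor `E(δ) = (4 B / √n) (1 + √(ln(1/δ) / 2))`. -/
noncomputable def errFactor (B : ℝ) (n : ℕ) (δ : ℝ) : ℝ :=
  4 * B / Real.sqrt n * (1 + Real.sqrt (Real.log (1 / δ) / 2))

/-- The eigengap `λ_k - λ_{k+1}` of a symmetric matrix. -/
noncomputable def eigengap {d : ℕ} {A : Matrix (Fin d) (Fin d) ℝ} (hA : A.IsHermitian) (k : ℕ) :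
    ℝ :=
  eigval hA k - eigval hA (k + 1)

/-- The error index `e(k) = √k / (λˢ_k - λˢ_{k+1}) + √k / (λᵗ_k - λᵗ_{k+1})`. -/
noncomputable def errIndex {d : ℕ} {Cs Ct : Matrix (Fin d) (Fin d) ℝ} (hs : Cs.IsHermitian)
    (ht : Ct.IsHermitian) (k : ℕ) : ℝ :=
  Real.sqrt k / eigengap hs k + Real.sqrt k / eigengap ht k

/-!
The Grassmannian distance of two dominant subspaces is stable under perturbation of the matrices,
and sample covariances concentrate around the true ones.

*Stability.* The projection `P` onto the span of the first `k` eigenvectors of `A` maximises the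
trace `tr (A Q)` over projections `Q` of rank `k`, and the maximum has curvature: by Ky Fan's
inequality with a gap term (`exists_trace_add_gap_le`), `tr (A P) - tr (A Q)` is at least half the
eigengap times `‖P - Q‖²`. Comparing the maximisers of two matrices yields a Davis–Kahan inequality
`‖P - P'‖ ≤ 2 ‖A' - A‖ / gap` (`eigengap_mul_frobNorm_proj_sub_le`), which asks nothing of the
eigengap of `A'`. As `‖P - Q‖ ≤ √(2 k)` for any two projections of rank `k`, the squared distances
change by at most `2 √(2 k)` times the sum of the two perturbations (`abs_grassDist_sub_le`).

*Concentration.* With data of norm at most `√B`, replacing one sample point moves the sample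
covariance by at most `6 B / n`, and its expected deviation from the covariance is at most
`3 B / √n`. McDiarmid's inequality (`measureReal_ge_le_of_bounded_differences`), proved by induction
on the number of variables from Hoeffding's lemma, bounds the deviation by `2 E(δ)` with probability
at least `1 - δ / 2` (`measure_le_frobNorm_sampleCovMatrix_sub`). The two samples need not be
independent of each other: a union bound combines them, and the factor `d⁻² ≤ 1 / 4` in the distance
pays both for it and for the crude constants.
-/

/-! ### The Frobenius norm as a Euclidean norm -/

/-- A matrix as a vector of `ℝᵈˣᵈ`; its Euclidean norm is the Frobenius norm. -/
noncomputable def matVec {d : ℕ} (M : Matrix (Fin d) (Fin d) ℝ) :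
    EuclideanSpace ℝ (Fin d × Fin d) :=
  WithLp.toLp 2 fun p => M p.1 p.2

theorem matVec_sub {d : ℕ} (M N : Matrix (Fin d) (Fin d) ℝ) :
    matVec (M - N) = matVec M - matVec N := rfl

theorem norm_matVec {d : ℕ} (M : Matrix (Fin d) (Fin d) ℝ) : ‖matVec M‖ = frobNorm M := by
  rw [EuclideanSpace.norm_eq, frobNorm, Fintype.sum_prod_type]
  simp [matVec]

theorem frobNorm_nonneg {d : ℕ} (M : Matrix (Fin d) (Fin d) ℝ) : 0 ≤ frobNorm M :=
  Real.sqrt_nonneg _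

theorem frobNorm_sq {d : ℕ} (M : Matrix (Fin d) (Fin d) ℝ) :
    frobNorm M ^ 2 = (M * M.transpose).trace := by
  rw [frobNorm, Real.sq_sqrt (by positivity)]
  simp [Matrix.trace, Matrix.mul_apply, sq]

theorem trace_mul_le_frobNorm {d : ℕ} (M N : Matrix (Fin d) (Fin d) ℝ) :
    (M * N.transpose).trace ≤ frobNorm M * frobNorm N := by
  rw [← norm_matVec, ← norm_matVec]
  refine le_trans (le_of_eq ?_) (real_inner_le_norm (matVec M) (matVec N))
  simp [Matrix.trace, Matrix.mul_apply, matVec, PiLp.inner_apply, Fintype.sum_prod_type, mul_comm]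

/-! ### Projections onto dominant eigenspaces -/

theorem eigval_antitone {d : ℕ} {A : Matrix (Fin d) (Fin d) ℝ} (hA : A.IsHermitian) {i j : ℕ}
    (hi : 1 ≤ i) (hij : i ≤ j) (hj : j ≤ d) : eigval hA j ≤ eigval hA i := by
  rw [eigval, eigval, dif_pos ⟨by omega, hj⟩, dif_pos ⟨hi, by omega⟩]
  exact hA.eigenvalues₀_antitone (by simp only [Fin.mk_le_mk]; omega)

theorem trace_proj {d k : ℕ} {V : Matrix (Fin d) (Fin k) ℝ} (hV : V.transpose * V = 1) :
    (V * V.transpose).trace = k := by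
  rw [Matrix.trace_mul_comm, hV]; simp

theorem proj_mul_self {d k : ℕ} {V : Matrix (Fin d) (Fin k) ℝ} (hV : V.transpose * V = 1) :
    V * V.transpose * (V * V.transpose) = V * V.transpose := by
  rw [Matrix.mul_assoc, ← Matrix.mul_assoc V.transpose, hV, Matrix.one_mul]

theorem frobNorm_proj_sub_sq {d k : ℕ} {U V : Matrix (Fin d) (Fin k) ℝ}
    (hU : U.transpose * U = 1) (hV : V.transpose * V = 1) :
    frobNorm (U * U.transpose - V * V.transpose) ^ 2 =
      2 * (k - (U * U.transpose * (V * V.transpose)).trace) := by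
  rw [frobNorm_sq]
  simp only [Matrix.transpose_sub, Matrix.transpose_mul, Matrix.transpose_transpose,
    Matrix.sub_mul, Matrix.mul_sub, Matrix.trace_sub, proj_mul_self hU, proj_mul_self hV,
    trace_proj hU, trace_proj hV, Matrix.trace_mul_comm (V * V.transpose) (U * U.transpose)]
  ring

theorem frobNorm_proj_sub_sq_le {d k : ℕ} {U V : Matrix (Fin d) (Fin k) ℝ}
    (hU : U.transpose * U = 1) (hV : V.transpose * V = 1) :
    frobNorm (U * U.transpose - V * V.transpose) ^ 2 ≤ 2 * k := by
  have h : (U * U.transpose * (V * V.transpose)).trace =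
      (U.transpose * V * (U.transpose * V).transpose).trace := by
    rw [Matrix.mul_assoc U, Matrix.trace_mul_comm U]
    simp [Matrix.transpose_mul, Matrix.mul_assoc]
  have h0 : 0 ≤ (U.transpose * V * (U.transpose * V).transpose).trace := by
    simp only [Matrix.trace, Matrix.diag, Matrix.mul_apply, Matrix.transpose_apply]
    exact Finset.sum_nonneg fun i _ => Finset.sum_nonneg fun j _ => mul_self_nonneg _
  rw [frobNorm_proj_sub_sq hU hV]
  linarith

/-- The spectral theorem with the eigenvalues in decreasing order. -/
theorem exists_spectral {d : ℕ} {A : Matrix (Fin d) (Fin d) ℝ} (hA : A.IsHermitian) :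
    ∃ E : Matrix (Fin d) (Fin d) ℝ, E.transpose * E = 1 ∧ E * E.transpose = 1 ∧
      A = E * Matrix.diagonal (fun i : Fin d => eigval hA (i + 1)) * E.transpose := by
  obtain ⟨E, hE, hcol⟩ := exists_isDominantFrame le_rfl hA
  have hE' : E * E.transpose = 1 := mul_eq_one_comm.1 hE
  refine ⟨E, hE, hE', ?_⟩
  have h : A * E = E * Matrix.diagonal (fun i : Fin d => eigval hA (i + 1)) := by
    ext i j
    have := congrFun (hcol j) i
    rw [Matrix.mul_diagonal, mul_comm]
    exact this
  rw [← h, Matrix.mul_assoc, hE', Matrix.mul_one]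

theorem trace_mul_proj_of_isDominantFrame {d k : ℕ} {A : Matrix (Fin d) (Fin d) ℝ}
    (hA : A.IsHermitian) {U : Matrix (Fin d) (Fin k) ℝ} (hU : IsDominantFrame hA U) :
    (A * (U * U.transpose)).trace = ∑ j : Fin k, eigval hA (j + 1) := by
  have h : A * U = U * Matrix.diagonal (fun i : Fin k => eigval hA (i + 1)) := by
    ext i j
    have := congrFun (hU.2 j) i
    rw [Matrix.mul_diagonal, mul_comm]
    exact this
  rw [← Matrix.mul_assoc, h, Matrix.trace_mul_comm, ← Matrix.mul_assoc, hU.1, Matrix.one_mul,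
    Matrix.trace_diagonal]

/-- Ky Fan's inequality with a gap term: among rank-`k` projections `V Vᵀ` the trace of `A V Vᵀ` is
largest at a dominant one, and it drops at least at the rate of the eigengap as one moves away. -/
theorem exists_trace_add_gap_le {d k : ℕ} (hk : 1 ≤ k) (hkd : k < d)
    {A : Matrix (Fin d) (Fin d) ℝ} (hA : A.IsHermitian) :
    ∃ U : Matrix (Fin d) (Fin k) ℝ, U.transpose * U = 1 ∧
      ∀ V : Matrix (Fin d) (Fin k) ℝ, V.transpose * V = 1 →
        (A * (V * V.transpose)).trace +
          eigengap hA k * (k - (U * U.transpose * (V * V.transpose)).trace) ≤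
            ∑ j : Fin k, eigval hA (j + 1) := by
  obtain ⟨m, rfl⟩ : ∃ m, d = k + m := ⟨d - k, by omega⟩
  obtain ⟨E, hE, hE', hAE⟩ := exists_spectral hA
  refine ⟨E.submatrix id (Fin.castAdd m), ?_, fun V hV => ?_⟩
  · ext i j
    have := congrFun (congrFun hE (Fin.castAdd m i)) (Fin.castAdd m j)
    simp only [Matrix.mul_apply, Matrix.transpose_apply, Matrix.one_apply, Fin.castAdd_inj] at this
    simpa [Matrix.mul_apply, Matrix.one_apply] using this
  set W : Matrix (Fin (k + m)) (Fin k) ℝ := E.transpose * V with hWdef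
  have hW : W.transpose * W = 1 := by
    rw [hWdef, Matrix.transpose_mul, Matrix.transpose_transpose, Matrix.mul_assoc,
      ← Matrix.mul_assoc E, hE', Matrix.one_mul, hV]
  set w : Fin (k + m) → ℝ := fun i => (W * W.transpose) i i with hw
  have hw0 : ∀ i, 0 ≤ w i := fun i => by
    simp only [hw, Matrix.mul_apply, Matrix.transpose_apply]
    exact Finset.sum_nonneg fun j _ => mul_self_nonneg _
  -- the diagonal entries of a projection are at most `1`
  have hw1 : ∀ i, w i ≤ 1 := fun i => by
    have h1 : w i = ∑ j, (W * W.transpose) i j ^ 2 := by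
      have hsymm : (W * W.transpose).transpose = W * W.transpose := by simp
      have h2 := congrFun (congrFun (proj_mul_self hW) i) i
      rw [Matrix.mul_apply] at h2
      rw [hw]
      simp only
      rw [← h2]
      refine Finset.sum_congr rfl fun j _ => ?_
      rw [sq]
      congr 1
      exact congrFun (congrFun hsymm i) j
    have h3 : w i ^ 2 ≤ w i := by
      conv_rhs => rw [h1]
      exact Finset.single_le_sum (f := fun j => (W * W.transpose) i j ^ 2)
        (fun j _ => sq_nonneg _) (Finset.mem_univ i)
    nlinarith [hw0 i]
  have hsum : ∑ i, w i = k := trace_proj hW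
  have htr : (A * (V * V.transpose)).trace =
      ∑ i : Fin (k + m), eigval hA ((i : ℕ) + 1) * w i := by
    have : (A * (V * V.transpose)).trace =
        (Matrix.diagonal (fun i : Fin (k + m) => eigval hA (i + 1)) * (W * W.transpose)).trace := by
      conv_lhs => rw [hAE]
      rw [hWdef, Matrix.transpose_mul, Matrix.transpose_transpose, Matrix.mul_assoc E,
        Matrix.mul_assoc E, Matrix.trace_mul_comm]
      simp only [Matrix.mul_assoc]
    rw [this]
    simp [Matrix.trace, Matrix.diagonal_mul, hw]
  have htr' : (E.submatrix id (Fin.castAdd m) * (E.submatrix id (Fin.castAdd m)).transpose *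
      (V * V.transpose)).trace = ∑ i : Fin k, w (Fin.castAdd m i) := by
    rw [Matrix.mul_assoc, Matrix.trace_mul_comm]
    have : (E.submatrix id (Fin.castAdd m)).transpose * (V * V.transpose) *
        E.submatrix id (Fin.castAdd m) =
        (W * W.transpose).submatrix (Fin.castAdd m) (Fin.castAdd m) := by
      rw [hWdef, Matrix.transpose_mul, Matrix.transpose_transpose]
      simp only [Matrix.mul_assoc]
      ext i j
      simp [Matrix.mul_apply]
    rw [this]
    simp [Matrix.trace, hw]
  rw [htr, htr', Fin.sum_univ_add]
  rw [Fin.sum_univ_add] at hsum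
  have hfirst : ∑ i : Fin k, eigval hA k * (1 - w (Fin.castAdd m i)) ≤
      ∑ i : Fin k, eigval hA ((i : ℕ) + 1) * (1 - w (Fin.castAdd m i)) :=
    Finset.sum_le_sum fun i _ => mul_le_mul_of_nonneg_right
      (eigval_antitone hA (by omega) (by omega) (by omega)) (by linarith [hw1 (Fin.castAdd m i)])
  have hlast : ∑ i : Fin m, eigval hA ((Fin.natAdd k i : ℕ) + 1) * w (Fin.natAdd k i) ≤
      ∑ i : Fin m, eigval hA (k + 1) * w (Fin.natAdd k i) :=
    Finset.sum_le_sum fun i _ => mul_le_mul_of_nonneg_right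
      (eigval_antitone hA (by omega) (by simp) (by simp)) (hw0 _)
  simp only [mul_sub, mul_one, Finset.sum_sub_distrib, ← Finset.mul_sum] at hfirst hlast
  simp only [Finset.sum_const, Finset.card_univ, Fintype.card_fin, nsmul_eq_mul] at hfirst
  have hm : ∑ i : Fin m, w (Fin.natAdd k i) = k - ∑ i : Fin k, w (Fin.castAdd m i) := by linarith
  rw [hm] at hlast
  simp only [Fin.val_castAdd, eigengap]
  nlinarith

/-- A Davis–Kahan inequality that involves the eigengap of only one of the two matrices. For the
projections `P` and `Q` onto the dominant subspaces of `A` and `A'`, the gap gives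
`gap / 2 * ‖P - Q‖² ≤ tr A (P - Q)`, maximality of `Q` for `A'` gives `0 ≤ tr A' (Q - P)`, and the
sum is bounded by Cauchy–Schwarz. -/
theorem eigengap_mul_frobNorm_proj_sub_le {d k : ℕ} (hk : 1 ≤ k) (hkd : k < d)
    {A A' : Matrix (Fin d) (Fin d) ℝ} (hA : A.IsHermitian) (hA' : A'.IsHermitian)
    (hgap : 0 < eigengap hA k) {U V : Matrix (Fin d) (Fin k) ℝ}
    (hU : IsDominantFrame hA U) (hV : IsDominantFrame hA' V) :
    eigengap hA k * frobNorm (U * U.transpose - V * V.transpose) ≤ 2 * frobNorm (A' - A) := by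
  obtain ⟨U₀, hU₀, hmax⟩ := exists_trace_add_gap_le hk hkd hA
  obtain ⟨V₀, hV₀, hmax'⟩ := exists_trace_add_gap_le hk hkd hA'
  -- the gap makes the maximiser unique: all dominant frames of `A` span the same subspace
  have hUU₀ : U * U.transpose = U₀ * U₀.transpose := by
    have h1 := hmax U hU.1
    rw [trace_mul_proj_of_isDominantFrame hA hU] at h1
    have h2 := frobNorm_proj_sub_sq hU₀ hU.1
    have h3 : frobNorm (U₀ * U₀.transpose - U * U.transpose) ^ 2 ≤ 0 := by
      rw [h2]; nlinarith
    have h4 : frobNorm (U₀ * U₀.transpose - U * U.transpose) = 0 :=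
      pow_eq_zero_iff (two_ne_zero) |>.1 (le_antisymm h3 (sq_nonneg _))
    rw [← norm_matVec, norm_eq_zero] at h4
    ext i j
    have h5 := congrArg (fun v : EuclideanSpace ℝ (Fin d × Fin d) => v (i, j)) h4
    simp only [matVec, Matrix.sub_apply, PiLp.zero_apply] at h5
    linarith
  have h1 := hmax V hV.1
  rw [← hUU₀, ← trace_mul_proj_of_isDominantFrame hA hU] at h1
  have h2 : (A' * (U * U.transpose)).trace ≤ (A' * (V * V.transpose)).trace := by
    have h3 := hmax' U hU.1
    rw [← trace_mul_proj_of_isDominantFrame hA' hV] at h3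
    have h4 : 0 ≤ eigengap hA' k :=
      sub_nonneg.2 (eigval_antitone hA' hk (by omega) (by omega))
    have h5 := frobNorm_proj_sub_sq hV₀ hU.1
    nlinarith [sq_nonneg (frobNorm (V₀ * V₀.transpose - U * U.transpose)),
      mul_nonneg h4 (sq_nonneg (frobNorm (V₀ * V₀.transpose - U * U.transpose)))]
  have h3 := frobNorm_proj_sub_sq hU.1 hV.1
  have h4 := trace_mul_le_frobNorm (A' - A) (V * V.transpose - U * U.transpose)
  have h5 : frobNorm (V * V.transpose - U * U.transpose) =
      frobNorm (U * U.transpose - V * V.transpose) := by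
    rw [← norm_matVec, ← norm_matVec, matVec_sub, matVec_sub, norm_sub_rev]
  rw [h5] at h4
  simp only [Matrix.transpose_sub, Matrix.transpose_mul, Matrix.transpose_transpose,
    Matrix.sub_mul, Matrix.mul_sub, Matrix.trace_sub] at h4
  set x := frobNorm (U * U.transpose - V * V.transpose)
  rcases (frobNorm_nonneg (U * U.transpose - V * V.transpose)).eq_or_lt with hx | hx
  · have : x = 0 := hx.symm
    rw [this]; simpa using frobNorm_nonneg _
  · refine le_of_mul_le_mul_right ?_ hx
    change _ * x ≤ _ * x
    nlinarith

/-! ### The bounded differences inequality -/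

/-- McDiarmid's inequality on the level of moment generating functions: a function of independent
variables which changes by at most `c` with each variable is sub-Gaussian about its mean. -/
theorem hasSubgaussianMGF_of_bounded_differences {E : Type*} [MeasurableSpace E]
    (μ : Measure E) [IsProbabilityMeasure μ] {c M : ℝ} (hc : 0 ≤ c) (n : ℕ)
    (f : (Fin n → E) → ℝ) (hf : Measurable f) (hM : ∀ x, |f x| ≤ M)
    (hdiff : ∀ x i y, |f (Function.update x i y) - f x| ≤ c) :
    HasSubgaussianMGF (fun x => f x - ∫ z, f z ∂(Measure.pi fun _ => μ))
      (n * (c.toNNReal / 2) ^ 2) (Measure.pi fun _ => μ) := by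
  induction n with
  | zero =>
    have hconst : (fun x => f x - ∫ z, f z ∂(Measure.pi fun _ : Fin 0 => μ)) = fun _ => 0 := by
      funext x
      have : f = fun _ => f x := funext fun z => congrArg f (Subsingleton.elim _ _)
      rw [this]; simp
    rw [hconst]
    simp
  | succ n ih =>
    obtain ⟨y₀⟩ : Nonempty E := nonempty_of_isProbabilityMeasure μ
    set π : Measure (Fin n → E) := Measure.pi fun _ => μ with hπ
    set F : (Fin n → E) → E → ℝ := fun x y => f (Fin.cons y x) with hF
    have hmp := measurePreserving_piFinSuccAbove (fun _ : Fin (n + 1) => μ) 0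
    have hFm : Measurable fun p : E × (Fin n → E) => F p.2 p.1 := by
      have := hf.comp (MeasurableEquiv.piFinSuccAbove (fun _ : Fin (n + 1) => E) 0).symm.measurable
      convert this using 1
      funext p
      simp [F, MeasurableEquiv.piFinSuccAbove, Fin.insertNthEquiv]
    have hFm' : ∀ x, Measurable (F x) := fun x => hFm.comp (measurable_id.prodMk measurable_const)
    have key : ∀ h : ℝ → ℝ, ∫ x, h (f x) ∂(Measure.pi fun _ : Fin (n + 1) => μ) =
        ∫ p, h (F p.2 p.1) ∂(μ.prod π) := by
      intro h
      rw [← hmp.integral_comp (MeasurableEquiv.measurableEmbedding _)]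
      congr 1
      funext x
      congr 2
      simp only [MeasurableEquiv.piFinSuccAbove, Fin.insertNthEquiv]
      exact (Fin.cons_self_tail x).symm
    set g : (Fin n → E) → ℝ := fun x => ∫ y, F x y ∂μ with hg
    have hgm : Measurable g :=
      (hFm.comp measurable_swap).stronglyMeasurable.integral_prod_right.measurable
    have hFi : ∀ x, Integrable (F x) μ := fun x =>
      Integrable.of_bound (hFm' x).aestronglyMeasurable M (Filter.Eventually.of_forall fun y => hM _)
    have hgM : ∀ x, |g x| ≤ M := fun x =>
      (norm_integral_le_of_norm_le_const (μ := μ) (f := F x) (C := M)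
        (Filter.Eventually.of_forall fun y => hM _)).trans (by simp)
    have hgdiff : ∀ x i y, |g (Function.update x i y) - g x| ≤ c := fun x i y => by
      simp only [hg]
      rw [← integral_sub (hFi _) (hFi _)]
      refine (norm_integral_le_of_norm_le_const (μ := μ) (C := c)
        (f := fun y' => F (Function.update x i y) y' - F x y')
        (Filter.Eventually.of_forall fun y' => ?_)).trans (by simp)
      simp only [hF, Fin.cons_update, Real.norm_eq_abs]
      exact hdiff _ _ _
    have hmean : ∫ z, f z ∂(Measure.pi fun _ : Fin (n + 1) => μ) = ∫ x, g x ∂π := by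
      have h := key id
      simp only [id] at h
      rw [h, integral_prod_symm]
      exact Integrable.of_bound hFm.aestronglyMeasurable M (Filter.Eventually.of_forall fun _ => hM _)
    rw [hmean]
    set m := ∫ x, g x ∂π with hm
    have hm_le : |m| ≤ M := 
      (norm_integral_le_of_norm_le_const (μ := π) (f := g) (C := M)
        (Filter.Eventually.of_forall hgM)).trans (by simp)
    have hexp : ∀ t a : ℝ, |a| ≤ M → ‖Real.exp (t * (a - m))‖ ≤ Real.exp (|t| * (M + M)) := by
      intro t a ha
      rw [Real.norm_eq_abs, Real.abs_exp, Real.exp_le_exp]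
      refine (le_abs_self _).trans ?_
      rw [abs_mul]
      exact mul_le_mul_of_nonneg_left ((abs_sub _ _).trans (add_le_add ha hm_le)) (abs_nonneg t)
    -- Hoeffding's lemma in the first variable, the others being fixed
    have hoeff : ∀ x, HasSubgaussianMGF (fun y => F x y - g x) ((c.toNNReal / 2) ^ 2) μ := by
      intro x
      have hbdd : BddBelow (Set.range (F x)) := ⟨-M, by
        rintro _ ⟨y, rfl⟩
        exact (abs_le.1 (hM _)).1⟩
      have : Nonempty E := ⟨y₀⟩
      have h := hasSubgaussianMGF_of_mem_Icc (μ := μ) (X := F x) (a := ⨅ y, F x y)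
        (b := (⨅ y, F x y) + c) (hFm' x).aemeasurable
        (Filter.Eventually.of_forall fun y => ⟨ciInf_le hbdd y, by
          rw [← sub_le_iff_le_add]
          refine le_ciInf fun y' => ?_
          have := (abs_le.1 (hdiff (Fin.cons y' x) 0 y)).2
          rw [Fin.update_cons_zero] at this
          simp only [hF]
          linarith⟩)
      have hcc : ‖(⨅ y, F x y) + c - ⨅ y, F x y‖₊ = c.toNNReal := by
        rw [add_sub_cancel_left]
        ext
        simp [hc, abs_of_nonneg]
      rwa [hcc] at h
    have ihg := ih g hgm hgM hgdiff
    refine ⟨fun t => ?_, fun t => ?_⟩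
    · exact Integrable.of_bound (by fun_prop) _ (Filter.Eventually.of_forall fun x =>
        hexp t _ (hM x))
    · have h1 : mgf (fun x => f x - m) (Measure.pi fun _ : Fin (n + 1) => μ) t =
          ∫ x, Real.exp (t * (g x - m)) * mgf (fun y => F x y - g x) μ t ∂π := by
        rw [mgf, key fun a => Real.exp (t * (a - m)), integral_prod_symm]
        · refine integral_congr_ae (Filter.Eventually.of_forall fun x => ?_)
          simp only [mgf]
          rw [← integral_const_mul]
          refine integral_congr_ae (Filter.Eventually.of_forall fun y => ?_)
          simp only
          rw [← Real.exp_add]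
          congr 1
          ring
        · exact Integrable.of_bound 
            (((hFm.sub_const m).const_mul t).exp.aestronglyMeasurable) _
            (Filter.Eventually.of_forall fun p => hexp t _ (hM _))
      rw [h1]
      calc ∫ x, Real.exp (t * (g x - m)) * mgf (fun y => F x y - g x) μ t ∂π
          ≤ ∫ x, Real.exp (t * (g x - m)) *
              Real.exp (((c.toNNReal / 2) ^ 2 : NNReal) * t ^ 2 / 2) ∂π := by
            refine integral_mono_of_nonneg (Filter.Eventually.of_forall fun x =>
              mul_nonneg (Real.exp_pos _).le mgf_nonneg)
              ((ihg.integrable_exp_mul t).mul_const _) (Filter.Eventually.of_forall fun x => ?_)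
            exact mul_le_mul_of_nonneg_left ((hoeff x).mgf_le t) (Real.exp_pos _).le
        _ = mgf (fun x => g x - m) π t *
              Real.exp (((c.toNNReal / 2) ^ 2 : NNReal) * t ^ 2 / 2) := integral_mul_const _ _
        _ ≤ Real.exp ((n * (c.toNNReal / 2) ^ 2 : NNReal) * t ^ 2 / 2) *
              Real.exp (((c.toNNReal / 2) ^ 2 : NNReal) * t ^ 2 / 2) :=
            mul_le_mul_of_nonneg_right (ihg.mgf_le t) (Real.exp_pos _).le
        _ = _ := by
            rw [← Real.exp_add]
            congr 1
            push_cast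
            ring

/-- McDiarmid's inequality for independent, identically distributed variables. -/
theorem measureReal_ge_le_of_bounded_differences {E : Type*} [MeasurableSpace E]
    (μ : Measure E) [IsProbabilityMeasure μ] {c M : ℝ} (hc : 0 ≤ c) (n : ℕ)
    (f : (Fin n → E) → ℝ) (hf : Measurable f) (hM : ∀ x, |f x| ≤ M)
    (hdiff : ∀ x i y, |f (Function.update x i y) - f x| ≤ c) {t : ℝ} (ht : 0 ≤ t) :
    (Measure.pi fun _ => μ).real {x | ∫ z, f z ∂(Measure.pi fun _ => μ) + t ≤ f x} ≤
      Real.exp (-(2 * t ^ 2 / (n * c ^ 2))) := by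
  have h := (hasSubgaussianMGF_of_bounded_differences μ hc n f hf hM hdiff).measure_ge_le ht
  simp only [le_sub_iff_add_le'] at h
  refine h.trans (le_of_eq ?_)
  congr 1
  push_cast
  rw [Real.coe_toNNReal c hc, neg_div, neg_inj,
    show 2 * ((n : ℝ) * (c / 2) ^ 2) = n * c ^ 2 / 2 by ring, div_div_eq_mul_div]
  ring

/-! ### Concentration of the sample covariance -/

/-- The law of large numbers in expectation: the squared deviation is a sum of variances over the
coordinates, and variances of independent terms add, so that it has mean at most `R² / n`. -/
theorem integral_norm_mean_sub_le {E ι : Type*} [MeasurableSpace E] [Fintype ι]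
    (μ : Measure E) [IsProbabilityMeasure μ] {g : E → EuclideanSpace ℝ ι} (hg : Measurable g)
    {R : ℝ} (hR : ∀ x, ‖g x‖ ≤ R) {n : ℕ} (hn : 0 < n) {m : EuclideanSpace ℝ ι}
    (hm : ∀ i, m i = ∫ x, g x i ∂μ) :
    ∫ x, ‖(1 / (n : ℝ)) • ∑ k, g (x k) - m‖ ∂(Measure.pi fun _ : Fin n => μ) ≤
      R / Real.sqrt n := by
  obtain ⟨x₀⟩ : Nonempty E := nonempty_of_isProbabilityMeasure μ
  have hR0 : 0 ≤ R := (norm_nonneg _).trans (hR x₀)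
  have hn' : (0 : ℝ) < n := by exact_mod_cast hn
  set π : Measure (Fin n → E) := Measure.pi fun _ => μ with hπ
  have hgi : ∀ i, Measurable fun x => g x i := fun i => by fun_prop
  have hgiR : ∀ i x, ‖g x i‖ ≤ R := fun i x => (PiLp.norm_apply_le (g x) i).trans (hR x)
  have hgL : ∀ i, MemLp (fun x => g x i) 2 μ := fun i =>
    MemLp.of_bound (hgi i).aestronglyMeasurable R (Filter.Eventually.of_forall (hgiR i))
  set Z : (Fin n → E) → EuclideanSpace ℝ ι := fun x => (1 / (n : ℝ)) • ∑ k, g (x k) - m with hZ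
  have hZm : Measurable Z := by fun_prop
  have hZb : ∀ x, ‖Z x‖ ≤ R + ‖m‖ := fun x => by
    refine (norm_sub_le _ _).trans (add_le_add ?_ le_rfl)
    rw [norm_smul, Real.norm_eq_abs, abs_of_pos (by positivity), one_div, inv_mul_le_iff₀ hn']
    refine (norm_sum_le _ _).trans ((Finset.sum_le_sum fun k _ => hR (x k)).trans ?_)
    simp
  have hZL : MemLp (fun x => ‖Z x‖) 2 π :=
    MemLp.of_bound hZm.norm.aestronglyMeasurable (R + ‖m‖)
      (Filter.Eventually.of_forall fun x => by simpa using hZb x)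
  have hZi : ∀ i, Measurable fun x => Z x i := fun i => by fun_prop
  have hZiL : ∀ i, MemLp (fun x => Z x i) 2 π := fun i =>
    MemLp.of_bound (hZi i).aestronglyMeasurable (R + ‖m‖)
      (Filter.Eventually.of_forall fun x => (PiLp.norm_apply_le (Z x) i).trans (hZb x))
  have hcoord : ∀ i, ∫ x, Z x i ^ 2 ∂π ≤ (1 / n) * ∫ x, g x i ^ 2 ∂μ := fun i => by
    have hL : MemLp (fun x => g x i - m i) 2 μ := (hgL i).sub (memLp_const _)
    have hval : (fun x => Z x i) = fun x => (1 / n) *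
        (∑ k : Fin n, fun x : Fin n → E => g (x k) i - m i) x := by
      funext x
      simp only [hZ, PiLp.sub_apply, PiLp.smul_apply, WithLp.ofLp_sum, Finset.sum_apply,
        smul_eq_mul, Finset.sum_sub_distrib, Finset.sum_const, Finset.card_univ, Fintype.card_fin,
        nsmul_eq_mul]
      field_simp
    have hmean0 : ∫ x, (g x i - m i) ∂μ = 0 := by
      rw [integral_sub ((hgL i).integrable one_le_two) (integrable_const _), ← hm i]
      simp
    have hZ0 : ∫ x, Z x i ∂π = 0 := by
      rw [hval, integral_const_mul]
      simp only [Finset.sum_apply]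
      rw [integral_finsetSum]
      · rw [Finset.sum_eq_zero, mul_zero]
        intro k _
        rw [← hmean0]
        exact integral_comp_eval (μ := fun _ : Fin n => μ) (i := k)
          (f := fun y => g y i - m i) ((hgi i).sub_const _).aestronglyMeasurable
      · intro k _
        exact (hL.comp_measurePreserving
          (measurePreserving_eval (fun _ : Fin n => μ) k)).integrable one_le_two
    have hvar : variance (fun x => Z x i) π = (1 / n) * variance (fun x => g x i) μ := by
      rw [hval, variance_const_mul,
        variance_sum_pi (μ := fun _ : Fin n => μ) (X := fun _ y => g y i - m i) fun _ => hL]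
      simp only [variance_sub_const (hgi i).aestronglyMeasurable, Finset.sum_const,
        Finset.card_univ, Fintype.card_fin, nsmul_eq_mul]
      field_simp
    rw [← variance_of_integral_eq_zero (hZi i).aemeasurable hZ0, hvar]
    exact mul_le_mul_of_nonneg_left (variance_le_expectation_sq (hgi i).aestronglyMeasurable)
      (by positivity)
  have hsq : ∫ x, ‖Z x‖ ^ 2 ∂π ≤ R ^ 2 / n := by
    calc ∫ x, ‖Z x‖ ^ 2 ∂π = ∑ i, ∫ x, Z x i ^ 2 ∂π := by
          simp only [EuclideanSpace.real_norm_sq_eq]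
          exact integral_finsetSum _ fun i _ => (hZiL i).integrable_sq
      _ ≤ ∑ i, (1 / n) * ∫ x, g x i ^ 2 ∂μ := Finset.sum_le_sum fun i _ => hcoord i
      _ = (1 / n) * ∫ x, ‖g x‖ ^ 2 ∂μ := by
          simp only [EuclideanSpace.real_norm_sq_eq]
          rw [integral_finsetSum _ fun i _ => (hgL i).integrable_sq, Finset.mul_sum]
      _ ≤ (1 / n) * R ^ 2 := by
          refine mul_le_mul_of_nonneg_left ?_ (by positivity)
          calc ∫ x, ‖g x‖ ^ 2 ∂μ ≤ ∫ _, R ^ 2 ∂μ :=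
                integral_mono_of_nonneg (Filter.Eventually.of_forall fun x => sq_nonneg _)
                  (integrable_const _) (Filter.Eventually.of_forall fun x =>
                    pow_le_pow_left₀ (norm_nonneg _) (hR x) 2)
            _ = R ^ 2 := by simp
      _ = R ^ 2 / n := by ring
  have hv := variance_nonneg (fun x => ‖Z x‖) π
  rw [variance_eq_sub hZL] at hv
  simp only [Pi.pow_apply] at hv
  refine le_of_sq_le_sq ?_ (by positivity)
  rw [div_pow, Real.sq_sqrt hn'.le]
  linarith

/-- The rank-one matrix `v wᵀ` as a vector of `ℝᵈˣᵈ`. -/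
noncomputable def outerVec {d : ℕ} (v w : EuclideanSpace ℝ (Fin d)) :
    EuclideanSpace ℝ (Fin d × Fin d) :=
  WithLp.toLp 2 fun p => v p.1 * w p.2

theorem norm_outerVec {d : ℕ} (v w : EuclideanSpace ℝ (Fin d)) :
    ‖outerVec v w‖ = ‖v‖ * ‖w‖ := by
  rw [EuclideanSpace.norm_eq, EuclideanSpace.norm_eq, EuclideanSpace.norm_eq,
    ← Real.sqrt_mul (Finset.sum_nonneg fun _ _ => sq_nonneg _), Fintype.sum_prod_type,
    Finset.sum_mul_sum]
  simp [outerVec, mul_pow]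

theorem measurable_outerVec {d : ℕ} :
    Measurable fun v : EuclideanSpace ℝ (Fin d) => outerVec v v := by
  unfold outerVec
  fun_prop

theorem norm_outerVec_sub_le {d : ℕ} (v w : EuclideanSpace ℝ (Fin d)) :
    ‖outerVec v v - outerVec w w‖ ≤ (‖v‖ + ‖w‖) * ‖v - w‖ := by
  have h : outerVec v v - outerVec w w = outerVec v (v - w) + outerVec (v - w) w := by
    ext p
    simp only [outerVec, PiLp.sub_apply, PiLp.add_apply]
    ring
  rw [h]
  refine (norm_add_le _ _).trans (le_of_eq ?_)
  rw [norm_outerVec, norm_outerVec]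
  ring

theorem matVec_sampleCovMatrix {d n : ℕ} (hn : 0 < n) (x : Fin n → EuclideanSpace ℝ (Fin d)) :
    matVec (sampleCovMatrix x) =
      (1 / (n : ℝ)) • ∑ k, outerVec (x k) (x k) - outerVec (sampleMean x) (sampleMean x) := by
  have hn' : (n : ℝ) ≠ 0 := by positivity
  ext ⟨i, j⟩
  have hmean : ∀ l, ∑ k, x k l = n * sampleMean x l := fun l => by
    simp only [sampleMean, PiLp.smul_apply, WithLp.ofLp_sum, Finset.sum_apply, smul_eq_mul]
    field_simp
  simp only [matVec, sampleCovMatrix, Matrix.of_apply, PiLp.sub_apply, PiLp.smul_apply,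
    WithLp.ofLp_sum, Finset.sum_apply, smul_eq_mul, outerVec, sub_mul, mul_sub,
    Finset.sum_sub_distrib, ← Finset.sum_mul, ← Finset.mul_sum, hmean, Finset.sum_const,
    Finset.card_univ, Fintype.card_fin, nsmul_eq_mul]
  field_simp
  ring

theorem norm_mean_le {V : Type*} [NormedAddCommGroup V] [NormedSpace ℝ V] {n : ℕ} (hn : 0 < n)
    {x : Fin n → V} {R : ℝ} (hx : ∀ k, ‖x k‖ ≤ R) : ‖(1 / (n : ℝ)) • ∑ k, x k‖ ≤ R := by
  have hn' : (0 : ℝ) < n := by exact_mod_cast hn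
  rw [norm_smul, Real.norm_eq_abs, abs_of_pos (by positivity), one_div, inv_mul_le_iff₀ hn']
  exact (norm_sum_le _ _).trans ((Finset.sum_le_sum fun k _ => hx k).trans (by simp))

theorem mean_update_sub {E V : Type*} [NormedAddCommGroup V] [NormedSpace ℝ V] {n : ℕ}
    (g : E → V) (x : Fin n → E) (i : Fin n) (y : E) :
    (1 / (n : ℝ)) • ∑ k, g (Function.update x i y k) - (1 / (n : ℝ)) • ∑ k, g (x k) =
      (1 / (n : ℝ)) • (g y - g (x i)) := by
  rw [← smul_sub, ← Finset.sum_sub_distrib, Finset.sum_eq_single i]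
  · simp
  · intro k _ hk
    simp [hk]
  · simp

/-- With data of norm at most `√B`, one sample point moves the sample covariance by at most
`6 B / n`: the second moment contributes `2 B / n`, the squared mean `4 B / n`. -/
theorem norm_matVec_sampleCovMatrix_update_sub_le {E : Type*} {d n : ℕ} (hn : 0 < n) {B : ℝ}
    {φ : E → EuclideanSpace ℝ (Fin d)} (hφ : ∀ y, ‖φ y‖ ≤ Real.sqrt B) (hB : 0 ≤ B)
    (x : Fin n → E) (i : Fin n) (y : E) :
    ‖matVec (sampleCovMatrix fun k => φ (Function.update x i y k)) -
      matVec (sampleCovMatrix fun k => φ (x k))‖ ≤ 6 * B / n := by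
  have hn' : (0 : ℝ) < n := by exact_mod_cast hn
  rw [matVec_sampleCovMatrix hn, matVec_sampleCovMatrix hn, sub_sub_sub_comm,
    mean_update_sub (fun y => outerVec (φ y) (φ y))]
  have hinv : ‖1 / (n : ℝ)‖ = 1 / n := by
    rw [Real.norm_eq_abs, abs_of_pos (by positivity)]
  have h1 : ‖(1 / (n : ℝ)) • (outerVec (φ y) (φ y) - outerVec (φ (x i)) (φ (x i)))‖ ≤
      1 / n * (2 * B) := by
    rw [norm_smul, hinv]
    refine mul_le_mul_of_nonneg_left ((norm_sub_le _ _).trans ?_) (by positivity)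
    rw [norm_outerVec, norm_outerVec]
    have := mul_self_le_mul_self (norm_nonneg _) (hφ y)
    have := mul_self_le_mul_self (norm_nonneg _) (hφ (x i))
    rw [Real.mul_self_sqrt hB] at *
    linarith
  have h2 := norm_outerVec_sub_le (sampleMean fun k => φ (Function.update x i y k))
    (sampleMean fun k => φ (x k))
  have h3 : ‖(sampleMean fun k => φ (Function.update x i y k)) - sampleMean fun k => φ (x k)‖ ≤
      1 / n * (2 * Real.sqrt B) := by
    rw [sampleMean, sampleMean, mean_update_sub φ, norm_smul, hinv]
    refine mul_le_mul_of_nonneg_left ((norm_sub_le _ _).trans ?_) (by positivity)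
    linarith [hφ y, hφ (x i)]
  have h4 : ‖sampleMean fun k => φ (Function.update x i y k)‖ ≤ Real.sqrt B :=
    norm_mean_le hn fun k => hφ _
  have h5 : ‖sampleMean fun k => φ (x k)‖ ≤ Real.sqrt B := norm_mean_le hn fun k => hφ _
  have h6 := mul_le_mul (add_le_add h4 h5) h3 (norm_nonneg _) (by positivity)
  refine (norm_sub_le _ _).trans ((add_le_add h1 (h2.trans h6)).trans (le_of_eq ?_))
  rw [show (Real.sqrt B + Real.sqrt B) * (1 / n * (2 * Real.sqrt B)) =
    4 / n * (Real.sqrt B * Real.sqrt B) by ring, Real.mul_self_sqrt hB]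
  ring

/-- The covariance as second moment minus squared mean, both computed from any bounded
modification `φ` of the data. -/
theorem matVec_covMatrix {d : ℕ} (D : Measure (EuclideanSpace ℝ (Fin d)))
    [IsProbabilityMeasure D] {φ : EuclideanSpace ℝ (Fin d) → EuclideanSpace ℝ (Fin d)}
    (hφm : Measurable φ) (hφ : φ =ᵐ[D] id) {R : ℝ} (hR : ∀ x, ‖φ x‖ ≤ R)
    {S : EuclideanSpace ℝ (Fin d × Fin d)} {m : EuclideanSpace ℝ (Fin d)}
    (hS : ∀ p, S p = ∫ x, outerVec (φ x) (φ x) p ∂D) (hm : ∀ i, m i = ∫ x, φ x i ∂D) :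
    matVec (covMatrix D) = S - outerVec m m := by
  have hL : ∀ i, MemLp (fun x => φ x i) 2 D := fun i =>
    MemLp.of_bound (Measurable.aestronglyMeasurable (by fun_prop)) R
      (Filter.Eventually.of_forall fun x => (PiLp.norm_apply_le (φ x) i).trans (hR x))
  have hc : ∀ i, (fun x : EuclideanSpace ℝ (Fin d) => x i) =ᵐ[D] fun x => φ x i := fun i => by
    filter_upwards [hφ] with x hx
    rw [hx]; rfl
  ext ⟨i, j⟩
  simp only [matVec, covMatrix, Matrix.of_apply, PiLp.sub_apply, hS, outerVec, hm]
  have hcov : covariance (fun x : EuclideanSpace ℝ (Fin d) => x i) (fun x => x j) D =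
      covariance (fun x => φ x i) (fun x => φ x j) D := by
    rw [covariance, covariance, integral_congr_ae (hc i), integral_congr_ae (hc j)]
    refine integral_congr_ae ?_
    filter_upwards [hc i, hc j] with x hi hj
    rw [hi, hj]
  rw [hcov, covariance_eq_sub (hL i) (hL j)]
  rfl

/-- The second moment matrix contributes `B / √n`, the squared mean `2 √B · √B / √n`. -/
theorem integral_norm_sampleCovMatrix_sub_le {d n : ℕ} (hn : 0 < n)
    (D : Measure (EuclideanSpace ℝ (Fin d)))
    [IsProbabilityMeasure D] {φ : EuclideanSpace ℝ (Fin d) → EuclideanSpace ℝ (Fin d)}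
    (hφm : Measurable φ) (hφ : φ =ᵐ[D] id) {B : ℝ} (hB : 0 ≤ B) (hR : ∀ x, ‖φ x‖ ≤ Real.sqrt B) :
    ∫ x, ‖matVec (sampleCovMatrix fun k => φ (x k)) - matVec (covMatrix D)‖
      ∂(Measure.pi fun _ : Fin n => D) ≤ 3 * B / Real.sqrt n := by
  set S : EuclideanSpace ℝ (Fin d × Fin d) :=
    WithLp.toLp 2 fun p => ∫ x, outerVec (φ x) (φ x) p ∂D
  set m : EuclideanSpace ℝ (Fin d) := WithLp.toLp 2 fun i => ∫ x, φ x i ∂D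
  have hRR : ∀ x, ‖outerVec (φ x) (φ x)‖ ≤ B := fun x => by
    rw [norm_outerVec, ← Real.mul_self_sqrt hB]
    exact mul_self_le_mul_self (norm_nonneg _) (hR x)
  have hom : Measurable fun x => outerVec (φ x) (φ x) := measurable_outerVec.comp hφm
  have h1 := integral_norm_mean_sub_le D hom hRR hn (m := S) fun _ => rfl
  have h2 := integral_norm_mean_sub_le D hφm hR hn (m := m) fun _ => rfl
  have hmn : ‖m‖ ≤ Real.sqrt B := by
    have : m = ∫ x, φ x ∂D := by
      ext i
      exact (eval_integral_piLp (fun j => Integrable.of_bound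
        (Measurable.aestronglyMeasurable (by fun_prop)) _
        (Filter.Eventually.of_forall fun x => (PiLp.norm_apply_le (φ x) j).trans (hR x))) i).symm
    rw [this]
    exact (norm_integral_le_of_norm_le_const (Filter.Eventually.of_forall hR)).trans (by simp)
  have hint : ∀ {ι : Type} [Fintype ι] {g : EuclideanSpace ℝ (Fin d) → EuclideanSpace ℝ ι}
      {R : ℝ} (v : EuclideanSpace ℝ ι), Measurable g → (∀ x, ‖g x‖ ≤ R) →
      Integrable (fun x => ‖(1 / (n : ℝ)) • ∑ k, g (x k) - v‖)
        (Measure.pi fun _ : Fin n => D) := by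
    intro ι _ g R v hg hgR
    refine Integrable.of_bound (Measurable.aestronglyMeasurable (by fun_prop)) (R + ‖v‖)
      (Filter.Eventually.of_forall fun x => ?_)
    rw [norm_norm]
    exact (norm_sub_le _ _).trans (add_le_add (norm_mean_le hn fun k => hgR _) le_rfl)
  calc ∫ x, ‖matVec (sampleCovMatrix fun k => φ (x k)) - matVec (covMatrix D)‖
      ∂(Measure.pi fun _ : Fin n => D)
      ≤ ∫ x, (‖(1 / (n : ℝ)) • ∑ k, outerVec (φ (x k)) (φ (x k)) - S‖ +
          2 * Real.sqrt B * ‖(1 / (n : ℝ)) • ∑ k, φ (x k) - m‖)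
            ∂(Measure.pi fun _ : Fin n => D) := by
        refine integral_mono_of_nonneg (Filter.Eventually.of_forall fun x => norm_nonneg _)
          ((hint S hom hRR).add ((hint m hφm hR).const_mul _))
          (Filter.Eventually.of_forall fun x => ?_)
        simp only
        rw [matVec_sampleCovMatrix hn, matVec_covMatrix D hφm hφ hR (S := S) (m := m)
          (fun _ => rfl) fun _ => rfl, sub_sub_sub_comm]
        refine (norm_sub_le _ _).trans (add_le_add le_rfl ?_)
        refine (norm_outerVec_sub_le _ _).trans ?_
        refine mul_le_mul_of_nonneg_right ?_ (norm_nonneg _)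
        have : ‖sampleMean fun k => φ (x k)‖ ≤ Real.sqrt B := norm_mean_le hn fun k => hR _
        linarith
    _ = _ := by
        rw [integral_add (hint S hom hRR) ((hint m hφm hR).const_mul _), integral_const_mul]
    _ ≤ B / Real.sqrt n + 2 * Real.sqrt B * (Real.sqrt B / Real.sqrt n) :=
        add_le_add h1 (mul_le_mul_of_nonneg_left h2 (by positivity))
    _ = 3 * B / Real.sqrt n := by
        rw [show 2 * Real.sqrt B * (Real.sqrt B / Real.sqrt n) =
          2 * (Real.sqrt B * Real.sqrt B) / Real.sqrt n by ring, Real.mul_self_sqrt hB]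
        ring

theorem measurable_matVec_sampleCovMatrix {d n : ℕ} :
    Measurable fun x : Fin n → EuclideanSpace ℝ (Fin d) => matVec (sampleCovMatrix x) := by
  unfold matVec sampleCovMatrix sampleMean
  simp only [Matrix.of_apply]
  fun_prop

/-- `√(ln(2/δ)/2)` exceeds `√(ln(1/δ)/2)` by at most `√(ln 2 / 2) ≤ 5/6`. -/
theorem sqrt_log_two_div_le {δ : ℝ} (hδ : 0 < δ) (hδ1 : δ < 1) :
    Real.sqrt (Real.log (2 / δ) / 2) ≤ 5 / 6 + Real.sqrt (Real.log (1 / δ) / 2) := by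
  have hlog : Real.log (2 / δ) = Real.log 2 + Real.log (1 / δ) := by
    rw [← Real.log_mul (by norm_num) (by positivity)]
    congr 1
    ring
  have h1 : 0 ≤ Real.log (1 / δ) := Real.log_nonneg (by rw [le_div_iff₀ hδ]; linarith)
  have h2 := Real.sq_sqrt (show 0 ≤ Real.log (1 / δ) / 2 by positivity)
  have h3 := Real.log_two_lt_d9
  apply Real.sqrt_le_iff.2
  refine ⟨by positivity, ?_⟩
  rw [hlog]
  nlinarith [Real.sqrt_nonneg (Real.log (1 / δ) / 2)]

/-- With probability at least `1 - δ / 2` the sample covariance is within `2 E(δ)` of the true one: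
the mean deviation is at most `3 B / √n`, the fluctuation at most `6 B / √n · √(ln(2/δ)/2)`, and
`3 + 6 · 5 / 6 = 8`. -/
theorem measureReal_pi_le_norm_sampleCovMatrix_sub {d n : ℕ} (hn : 0 < n)
    (D : Measure (EuclideanSpace ℝ (Fin d)))
    [IsProbabilityMeasure D] {φ : EuclideanSpace ℝ (Fin d) → EuclideanSpace ℝ (Fin d)}
    (hφm : Measurable φ) (hφ : φ =ᵐ[D] id) {B : ℝ} (hB : 0 < B) (hR : ∀ x, ‖φ x‖ ≤ Real.sqrt B)
    {δ : ℝ} (hδ : 0 < δ) (hδ1 : δ < 1) :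
    (Measure.pi fun _ : Fin n => D).real {x | 2 * errFactor B n δ ≤
      ‖matVec (sampleCovMatrix fun k => φ (x k)) - matVec (covMatrix D)‖} ≤ δ / 2 := by
  have hn' : (0 : ℝ) < n := by exact_mod_cast hn
  have hRR : ∀ x, ‖outerVec (φ x) (φ x)‖ ≤ B := fun x => by
    rw [norm_outerVec, ← Real.mul_self_sqrt hB.le]
    exact mul_self_le_mul_self (norm_nonneg _) (hR x)
  set L := Real.sqrt (Real.log (2 / δ) / 2) with hL
  have hL2 : L ^ 2 = Real.log (2 / δ) / 2 :=
    Real.sq_sqrt (div_nonneg (Real.log_nonneg (by rw [le_div_iff₀ hδ]; linarith)) two_pos.le)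
  set f : (Fin n → EuclideanSpace ℝ (Fin d)) → ℝ := fun x =>
    ‖matVec (sampleCovMatrix fun k => φ (x k)) - matVec (covMatrix D)‖ with hf
  have hfm : Measurable f := by
    have : Measurable fun x : Fin n → EuclideanSpace ℝ (Fin d) => fun k => φ (x k) := by fun_prop
    exact ((measurable_matVec_sampleCovMatrix.comp this).sub_const _).norm
  have hfM : ∀ x, |f x| ≤ B + B + ‖matVec (covMatrix D)‖ := fun x => by
    rw [abs_of_nonneg (norm_nonneg _)]
    refine (norm_sub_le _ _).trans (add_le_add ?_ le_rfl)
    rw [matVec_sampleCovMatrix hn]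
    refine (norm_sub_le _ _).trans (add_le_add (norm_mean_le hn fun k => hRR _) ?_)
    have h : ‖sampleMean fun k => φ (x k)‖ ≤ Real.sqrt B := norm_mean_le hn fun k => hR _
    rw [norm_outerVec, ← Real.mul_self_sqrt hB.le]
    exact mul_self_le_mul_self (norm_nonneg _) h
  have hdiff : ∀ x i y, |f (Function.update x i y) - f x| ≤ 6 * B / n := fun x i y => by
    refine (abs_norm_sub_norm_le _ _).trans ?_
    rw [sub_sub_sub_cancel_right]
    exact norm_matVec_sampleCovMatrix_update_sub_le hn hR hB.le x i y
  have key := measureReal_ge_le_of_bounded_differences D (by positivity) n f hfm hfM hdiff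
    (t := 6 * B / Real.sqrt n * L) (by positivity)
  refine (measureReal_mono (fun x hx => ?_)).trans (key.trans (le_of_eq ?_))
  · have hmean := integral_norm_sampleCovMatrix_sub_le hn D hφm hφ hB.le hR
    have h1 := sqrt_log_two_div_le hδ hδ1
    simp only [Set.mem_ofPred_eq] at hx ⊢
    refine le_trans ?_ hx
    refine (add_le_add_left hmean _).trans ?_
    rw [errFactor]
    have hBn : 0 ≤ B / Real.sqrt n := by positivity
    have h2 := mul_le_mul_of_nonneg_left h1 hBn
    have h3 := mul_nonneg hBn (Real.sqrt_nonneg (Real.log (1 / δ) / 2))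
    have e1 : 3 * B / Real.sqrt n + 6 * B / Real.sqrt n * L =
        3 * (B / Real.sqrt n) + 6 * (B / Real.sqrt n * L) := by ring
    have e2 : 2 * (4 * B / Real.sqrt n * (1 + Real.sqrt (Real.log (1 / δ) / 2))) =
      8 * (B / Real.sqrt n) + 8 * (B / Real.sqrt n * Real.sqrt (Real.log (1 / δ) / 2)) := by ring
    rw [e1, e2]
    rw [mul_add] at h2
    linarith
  · have hexp : 2 * (6 * B / Real.sqrt n * L) ^ 2 / (n * (6 * B / n) ^ 2) =
        Real.log (2 / δ) := by
      rw [mul_pow, div_pow, Real.sq_sqrt hn'.le, hL2]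
      field_simp
    rw [hexp, Real.exp_neg, Real.exp_log (by positivity), inv_div]

/-- A distribution with positive eigengap is not concentrated at the origin. -/
theorem pos_of_eigengap_pos {d k : ℕ} (hk : 1 ≤ k) (hkd : k < d)
    (D : Measure (EuclideanSpace ℝ (Fin d))) [IsProbabilityMeasure D] {B : ℝ}
    (hB : ∀ᵐ x ∂D, ‖x‖ ^ 2 ≤ B) (hgap : 0 < eigengap (covMatrix_isHermitian D) k) : 0 < B := by
  by_contra! hB0
  have h0 : matVec (covMatrix D) = 0 := by
    rw [matVec_covMatrix D (φ := fun _ => 0) measurable_const ?_ (R := 0) (by simp) (S := 0)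
      (m := 0) (by simp [outerVec]) (by simp)]
    · ext p
      simp [outerVec]
    · filter_upwards [hB] with x hx
      have : ‖x‖ = 0 := by nlinarith [norm_nonneg x, sq_nonneg ‖x‖]
      simpa using (norm_eq_zero.1 this).symm
  have hC : covMatrix D = 0 := by
    ext i j
    exact congrArg (fun v : EuclideanSpace ℝ (Fin d × Fin d) => v (i, j)) h0
  obtain ⟨E, hE, -, hCE⟩ := exists_spectral (covMatrix_isHermitian D)
  have hdiag : Matrix.diagonal (fun i : Fin d => eigval (covMatrix_isHermitian D) (i + 1)) = 0 := by
    calc _ = E.transpose * (E * Matrix.diagonal (fun i : Fin d =>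
          eigval (covMatrix_isHermitian D) (i + 1)) * E.transpose) * E := by
          rw [Matrix.mul_assoc, Matrix.mul_assoc, Matrix.mul_assoc, hE, Matrix.mul_one,
            ← Matrix.mul_assoc, hE, Matrix.one_mul]
      _ = 0 := by rw [← hCE, hC]; simp
  have hz : ∀ i, 1 ≤ i → i ≤ d → eigval (covMatrix_isHermitian D) i = 0 := fun i h1 h2 => by
    have := congrFun (congrFun hdiag ⟨i - 1, by omega⟩) ⟨i - 1, by omega⟩
    simpa [Nat.sub_add_cancel h1] using this
  rw [eigengap, hz k hk hkd.le, hz (k + 1) (by omega) hkd] at hgap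
  simp at hgap

/-- The concentration bound for a sample given by independent random variables. -/
theorem measure_le_frobNorm_sampleCovMatrix_sub {Ω : Type*} [MeasurableSpace Ω] (P : Measure Ω)
    [IsProbabilityMeasure P] {d n : ℕ} (hn : 0 < n) (D : Measure (EuclideanSpace ℝ (Fin d)))
    [IsProbabilityMeasure D] {B δ : ℝ} (hB : 0 < B) (hδ : 0 < δ) (hδ1 : δ < 1)
    (hDB : ∀ᵐ x ∂D, ‖x‖ ^ 2 ≤ B) (X : Fin n → Ω → EuclideanSpace ℝ (Fin d))
    (hlaw : ∀ k, HasLaw (X k) D P) (hindep : iIndepFun X P) :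
    P {ω | 2 * errFactor B n δ ≤ frobNorm (sampleCovMatrix (fun k => X k ω) - covMatrix D)} ≤
      ENNReal.ofReal (δ / 2) := by
  -- truncation of the data, so that the bounds on them hold everywhere
  set φ : EuclideanSpace ℝ (Fin d) → EuclideanSpace ℝ (Fin d) :=
    fun x => if ‖x‖ ^ 2 ≤ B then x else 0 with hφdef
  have hφm : Measurable φ :=
    Measurable.ite (measurableSet_le (by fun_prop) measurable_const) measurable_id measurable_const
  have hφ : φ =ᵐ[D] id := by
    filter_upwards [hDB] with x hx
    simp [φ, hx]
  have hR : ∀ x, ‖φ x‖ ≤ Real.sqrt B := fun x => by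
    simp only [φ]
    split_ifs with h
    · exact Real.le_sqrt_of_sq_le h
    · simp
  have hXm : ∀ k, AEMeasurable (X k) P := fun k => (hlaw k).aemeasurable
  have hmap : P.map (fun ω k => X k ω) = Measure.pi fun _ => D := by
    rw [(iIndepFun_iff_map_fun_eq_pi_map hXm).1 hindep]
    simp only [(hlaw _).map_eq]
  have hae : ∀ᵐ ω ∂P, ∀ k, φ (X k ω) = X k ω := by
    rw [ae_all_iff]
    intro k
    have h := hφ
    rw [← (hlaw k).map_eq] at h
    exact ae_of_ae_map (hXm k) h
  set T : Set (Fin n → EuclideanSpace ℝ (Fin d)) := {x | 2 * errFactor B n δ ≤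
      ‖matVec (sampleCovMatrix fun k => φ (x k)) - matVec (covMatrix D)‖} with hT
  have hTm : MeasurableSet T := by
    have : Measurable fun x : Fin n → EuclideanSpace ℝ (Fin d) => fun k => φ (x k) := by fun_prop
    exact measurableSet_le measurable_const
      ((measurable_matVec_sampleCovMatrix.comp this).sub_const _).norm
  have hle : P {ω | 2 * errFactor B n δ ≤
      frobNorm (sampleCovMatrix (fun k => X k ω) - covMatrix D)} ≤
      P ((fun ω k => X k ω) ⁻¹' T) := by
    refine measure_mono_ae ?_
    filter_upwards [hae] with ω hω h
    change 2 * errFactor B n δ ≤ ‖matVec (sampleCovMatrix fun k => φ (X k ω)) - _‖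
    simp only [hω]
    rw [← matVec_sub, norm_matVec]
    exact h
  refine hle.trans ?_
  rw [← Measure.map_apply_of_aemeasurable (aemeasurable_pi_lambda _ hXm) hTm, hmap,
    ← ENNReal.ofReal_toReal (measure_ne_top _ T)]
  exact ENNReal.ofReal_le_ofReal
    (measureReal_pi_le_norm_sampleCovMatrix_sub hn D hφm hφ hB hR hδ hδ1)

/-! ### Stability of the Grassmannian distance -/

/-- For `a, b ≤ √(2 k)` the difference `a² - b²` is at most `2 √(2 k) |a - b|`; the normalisation
`d⁻² ≤ 1 / 4` leaves the factor `√(2 k) / 2`. -/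
theorem abs_grassDist_sub_le {d k : ℕ} (hd : 2 ≤ d) {U₁ U₂ V₁ V₂ : Matrix (Fin d) (Fin k) ℝ}
    (hU₁ : U₁.transpose * U₁ = 1) (hU₂ : U₂.transpose * U₂ = 1)
    (hV₁ : V₁.transpose * V₁ = 1) (hV₂ : V₂.transpose * V₂ = 1) :
    |grassDist U₁ U₂ - grassDist V₁ V₂| ≤ Real.sqrt (2 * k) / 2 *
      (frobNorm (U₁ * U₁.transpose - V₁ * V₁.transpose) +
        frobNorm (U₂ * U₂.transpose - V₂ * V₂.transpose)) := by
  have ha := Real.le_sqrt_of_sq_le (frobNorm_proj_sub_sq_le hU₁ hU₂)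
  have hb := Real.le_sqrt_of_sq_le (frobNorm_proj_sub_sq_le hV₁ hV₂)
  have hab : |frobNorm (U₁ * U₁.transpose - U₂ * U₂.transpose) -
      frobNorm (V₁ * V₁.transpose - V₂ * V₂.transpose)| ≤
      frobNorm (U₁ * U₁.transpose - V₁ * V₁.transpose) +
        frobNorm (U₂ * U₂.transpose - V₂ * V₂.transpose) := by
    simp only [← norm_matVec, matVec_sub]
    refine (abs_norm_sub_norm_le _ _).trans ?_
    rw [sub_sub_sub_comm]
    exact norm_sub_le _ _
  have ha0 := frobNorm_nonneg (U₁ * U₁.transpose - U₂ * U₂.transpose)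
  have hb0 := frobNorm_nonneg (V₁ * V₁.transpose - V₂ * V₂.transpose)
  rw [grassDist, grassDist]
  set a := frobNorm (U₁ * U₁.transpose - U₂ * U₂.transpose)
  set b := frobNorm (V₁ * V₁.transpose - V₂ * V₂.transpose)
  have hd' : 1 / (d : ℝ) ^ 2 ≤ 1 / 4 := by
    have : (2 : ℝ) ≤ d := by exact_mod_cast hd
    exact one_div_le_one_div_of_le (by norm_num) (by nlinarith)
  rw [show 1 / (d : ℝ) ^ 2 * a ^ 2 - 1 / (d : ℝ) ^ 2 * b ^ 2 =
    1 / (d : ℝ) ^ 2 * ((a + b) * (a - b)) by ring, abs_mul, abs_mul,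
    abs_of_nonneg (by positivity : (0 : ℝ) ≤ 1 / (d : ℝ) ^ 2),
    abs_of_nonneg (by positivity : 0 ≤ a + b)]
  calc 1 / (d : ℝ) ^ 2 * ((a + b) * |a - b|)
      ≤ 1 / 4 * ((Real.sqrt (2 * k) + Real.sqrt (2 * k)) * |a - b|) := by gcongr
    _ = Real.sqrt (2 * k) / 2 * |a - b| := by ring
    _ ≤ _ := mul_le_mul_of_nonneg_left hab (by positivity)

theorem theorem3 {Ω : Type*} [MeasurableSpace Ω] (P : Measure Ω) [IsProbabilityMeasure P]
    {d d' n : ℕ} (hd'_pos : 1 ≤ d') (hd'_lt : d' < d)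
    -- the source and target distributions, with data bounded by `B`
    (Ds Dt : Measure (EuclideanSpace ℝ (Fin d)))
    [IsProbabilityMeasure Ds] [IsProbabilityMeasure Dt]
    (B δ : ℝ) (hδ_pos : 0 < δ) (hδ_lt : δ < 1)
    (hBs : ∀ᵐ x ∂Ds, ‖x‖ ^ 2 ≤ B) (hBt : ∀ᵐ x ∂Dt, ‖x‖ ^ 2 ≤ B)
    -- the eigengaps at `d'`
    (hgap_s : eigval (covMatrix_isHermitian Ds) (d' + 1) < eigval (covMatrix_isHermitian Ds) d')
    (hgap_t : eigval (covMatrix_isHermitian Dt) (d' + 1) < eigval (covMatrix_isHermitian Dt) d')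
    -- the sample size
    (hn_s : (4 * B / eigengap (covMatrix_isHermitian Ds) d' *
      (1 + Real.sqrt (Real.log (1 / δ) / 2))) ^ 2 ≤ (n : ℝ))
    (hn_t : (4 * B / eigengap (covMatrix_isHermitian Dt) d' *
      (1 + Real.sqrt (Real.log (1 / δ) / 2))) ^ 2 ≤ (n : ℝ))
    -- i.i.d. samples from the two distributions
    (Xs Xt : Fin n → Ω → EuclideanSpace ℝ (Fin d))
    (hXs_law : ∀ k, HasLaw (Xs k) Ds P) (hXs_indep : iIndepFun Xs P)
    (hXt_law : ∀ k, HasLaw (Xt k) Dt P) (hXt_indep : iIndepFun Xt P)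
    -- first `d'` eigenvectors of the two true covariance matrices
    (Us Ut : Matrix (Fin d) (Fin d') ℝ)
    (hUs : IsDominantFrame (covMatrix_isHermitian Ds) Us)
    (hUt : IsDominantFrame (covMatrix_isHermitian Dt) Ut) :
    -- with probability at least `1 - δ`, whatever eigenvectors of the sample covariances are used
    ∃ A : Set Ω, MeasurableSet A ∧ ENNReal.ofReal (1 - δ) ≤ P A ∧
      ∀ ω ∈ A, ∀ Vs Vt : Matrix (Fin d) (Fin d') ℝ,
        IsDominantFrame (sampleCovMatrix_isHermitian fun k => Xs k ω) Vs →
        IsDominantFrame (sampleCovMatrix_isHermitian fun k => Xt k ω) Vt →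
        |grassDist Us Ut - grassDist Vs Vt| ≤
          2 * Real.sqrt 2 * errFactor B n δ *
            errIndex (covMatrix_isHermitian Ds) (covMatrix_isHermitian Dt) d' := by
  have hgs : 0 < eigengap (covMatrix_isHermitian Ds) d' := sub_pos.2 hgap_s
  have hgt : 0 < eigengap (covMatrix_isHermitian Dt) d' := sub_pos.2 hgap_t
  have hB : 0 < B := pos_of_eigengap_pos hd'_pos hd'_lt Ds hBs hgs
  -- the bound on the sample size excludes `n = 0`, as `B` and the eigengap are positive
  have hn : 0 < n := by
    have : (0 : ℝ) < n := lt_of_lt_of_le (by positivity) hn_s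
    exact_mod_cast this
  set E := errFactor B n δ with hE
  set bad : Measure (EuclideanSpace ℝ (Fin d)) → (Fin n → Ω → EuclideanSpace ℝ (Fin d)) → Set Ω :=
    fun D X => {ω | 2 * E ≤ frobNorm (sampleCovMatrix (fun k => X k ω) - covMatrix D)}
  have hbad : P (bad Ds Xs ∪ bad Dt Xt) ≤ ENNReal.ofReal δ := by
    refine (measure_union_le _ _).trans ((add_le_add
      (measure_le_frobNorm_sampleCovMatrix_sub P hn Ds hB hδ_pos hδ_lt hBs Xs hXs_law hXs_indep)
      (measure_le_frobNorm_sampleCovMatrix_sub P hn Dt hB hδ_pos hδ_lt hBt Xt hXt_law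
        hXt_indep)).trans (le_of_eq ?_))
    rw [← ENNReal.ofReal_add (by positivity) (by positivity), add_halves]
  -- the samples are only almost everywhere measurable, hence the measurable hull
  refine ⟨(toMeasurable P (bad Ds Xs ∪ bad Dt Xt))ᶜ, (measurableSet_toMeasurable _ _).compl, ?_,
    fun ω hω Vs Vt hVs hVt => ?_⟩
  · rw [prob_compl_eq_one_sub (measurableSet_toMeasurable _ _), measure_toMeasurable,
      ENNReal.ofReal_sub _ hδ_pos.le, ENNReal.ofReal_one]
    exact tsub_le_tsub_left hbad _
  have hω' : ω ∉ bad Ds Xs ∪ bad Dt Xt := fun h => hω (subset_toMeasurable _ _ h)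
  rw [Set.mem_union, not_or] at hω'
  have hs : frobNorm (sampleCovMatrix (fun k => Xs k ω) - covMatrix Ds) < 2 * E :=
    not_le.1 hω'.1
  have ht : frobNorm (sampleCovMatrix (fun k => Xt k ω) - covMatrix Dt) < 2 * E :=
    not_le.1 hω'.2
  have h1 : frobNorm (Us * Us.transpose - Vs * Vs.transpose) ≤
      4 * E / eigengap (covMatrix_isHermitian Ds) d' := by
    rw [le_div_iff₀ hgs, mul_comm]
    linarith [eigengap_mul_frobNorm_proj_sub_le hd'_pos hd'_lt _ _ hgs hUs hVs]
  have h2 : frobNorm (Ut * Ut.transpose - Vt * Vt.transpose) ≤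
      4 * E / eigengap (covMatrix_isHermitian Dt) d' := by
    rw [le_div_iff₀ hgt, mul_comm]
    linarith [eigengap_mul_frobNorm_proj_sub_le hd'_pos hd'_lt _ _ hgt hUt hVt]
  refine (abs_grassDist_sub_le (by omega) hUs.1 hUt.1 hVs.1 hVt.1).trans
    ((mul_le_mul_of_nonneg_left (add_le_add h1 h2) (by positivity)).trans (le_of_eq ?_))
  rw [errIndex, Real.sqrt_mul zero_le_two]
  ring
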